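/- Let $A$ be a finite alphabet, let $S$ be the shift on $A^{\mathbb Z}$, and let $\mu$ be an $S$-ergodic Borel probability measure on $A^{\mathbb Z}$ with support $X$. Let $\mathcal L(X)$ be the set of finite words occurring in elements of $X$, and for $L\subseteq A^*$ put $[L]=\{x\in X : x_0\cdots x_{n-1}\in L\text{ for some } n\ge 0\}$. A language $L\subseteq A^*$ has density $\delta_\mu(L)=\lim_{n\to\infty}\frac1n\sum_{i=0}^{n-1}\mu(\{x : x_0\cdots x_{i-1}\in L\})$ if this limit exists. Let $\varphi\colon A^*\to M$ be a morphism onto a finite monoid. Let $K_X(M)$ be the intersection of all two-sided ideals of $M$ that meet $\varphi(\mathcal L(X))$, and let $J_X(M)=\{m\in M : MmM=K_X(M)\}$. (1) If $m\in M\setminus J_X(M)$, then $L=\varphi^{-1}(m)$ has a density and $\delta_\mu(L)=0$. (2) Let $R$ be an $\mathscr R$-class of $M$ (a class of the relation $rM=sM$) contained in $J_X(M)$, and let $R\cup\{0\}$ be $R$ with a new element $0$ adjoined. For $r\in R$ and $m\in M$ put $r\cdot m=rm$ if $rm\in R$ and $r\cdot m=0$ otherwise; put $0\cdot m=0$. Let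 $T(r,x)=(r\cdot\varphi(x_0),Sx)$ on $(R\cup\{0\})\times X$. Then there is a $T$-ergodic Borel probability measure $\bar\mu$ on $(R\cup\{0\})\times X$ with $\bar\mu(\{0\}\times X)=0$ whose projection to $X$ is $\mu$. For every such $\bar\mu$ and every $m\in J_X(M)$, the language $L=\varphi^{-1}(m)$ has a density and $$\delta_\mu(L)=\sum_{r\in R,\ rm\in R}\bar\mu(\{r\}\times[L])\,\bar\mu(\{rm\}\times X).$$ -/

import Mathlib

open MeasureTheory Filter Topology

noncomputable section

namespace SkewDensity

open SymbolicDynamics.FullShift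

section Words

variable {A : Type*}

/-- The shift transformation `S` on `A^ℤ`: `(S x)_n = x_{n+1}`. -/
def S (x : ℤ → A) : ℤ → A := fun n => x (n + 1)

/-- The factor `x_i x_{i+1} ⋯ x_{i+n-1}` of `x`, an element of the free monoid on `A`. -/
def factor (x : ℤ → A) (i : ℤ) (n : ℕ) : FreeMonoid A :=
  FreeMonoid.ofList (List.ofFn fun k : Fin n => x (i + ((k : ℕ) : ℤ)))

/-- The set of finite words that occur in the elements of `X`. -/
def language (X : Set (ℤ → A)) : Set (FreeMonoid A) :=
  {w | ∃ x ∈ X, ∃ i : ℤ, factor x i w.length = w}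

/-- The language `L` has density `d` with respect to `μ`: the Cesàro means of the numbers
`μ {x | x_0 ⋯ x_{i-1} ∈ L}`, `i = 0, 1, 2, …`, converge to `d`. -/
def HasDensity [MeasurableSpace A] (μ : Measure (ℤ → A)) (L : Set (FreeMonoid A)) (d : ℝ) :
    Prop :=
  Tendsto (fun n : ℕ => (1 / (n : ℝ)) *
      ∑ i ∈ Finset.range n, μ.real {x | factor x 0 i ∈ L}) atTop (𝓝 d)

end Words

section Monoids

variable {M : Type*} [Monoid M]

/-- Two-sided ideals of a monoid: `M I M ⊆ I`. -/
def IsTwoSidedIdeal (I : Set M) : Prop := ∀ a b : M, ∀ x ∈ I, a * x * b ∈ I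

/-- The principal two-sided ideal `M m M`. -/
def principalIdeal (m : M) : Set M := {x | ∃ a b : M, x = a * m * b}

/-- The principal right ideal `m M`. -/
def principalRightIdeal (m : M) : Set M := {x | ∃ a : M, x = m * a}

/-- `R` is a class of Green's relation `𝓡`, where `r 𝓡 s` means `r M = s M`. -/
def IsRClass (R : Set M) : Prop :=
  ∃ r : M, R = {s | principalRightIdeal s = principalRightIdeal r}

variable {A : Type*}

/-- The `X`-minimal ideal `K_X(M)`: the intersection of all two-sided ideals of `M` that
meet the image of the language of `X`. -/
def minimalIdeal (φ : FreeMonoid A →* M) (X : Set (ℤ → A)) : Set M :=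
  ⋂₀ {I | IsTwoSidedIdeal I ∧ (I ∩ φ '' language X).Nonempty}

/-- `J_X(M)`: the elements that generate `K_X(M)` as a two-sided ideal. -/
def minimalJClass (φ : FreeMonoid A →* M) (X : Set (ℤ → A)) : Set M :=
  {m | principalIdeal m = minimalIdeal φ X}

/-- The finite set `R ∪ {0}`, where `0` is a new element (`none`), also when `M` has a zero
of its own. -/
def WithNewZero (R : Set M) : Type _ := Option R

namespace WithNewZero

variable {R : Set M}

/-- The new element `0`. -/
def zero : WithNewZero R := (none : Option R)

/-- The inclusion of `R` in `R ∪ {0}`. -/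
def of (r : R) : WithNewZero R := (some r : Option R)

instance : TopologicalSpace (WithNewZero R) := ⊥

instance : DiscreteTopology (WithNewZero R) := ⟨rfl⟩

instance : MeasurableSpace (WithNewZero R) := ⊤

instance : DiscreteMeasurableSpace (WithNewZero R) := ⟨fun _ => trivial⟩

instance [Finite M] : Finite (WithNewZero R) := inferInstanceAs (Finite (Option R))

open Classical in
/-- The right action of `M` on `R ∪ {0}`: `r · m = r m` if `r m ∈ R`, and `r · m = 0`
otherwise; `0 · m = 0`. -/
def act (p : WithNewZero R) (m : M) : WithNewZero R :=
  Option.elim (p : Option R) zero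
    (fun r => if h : (r : M) * m ∈ R then of ⟨(r : M) * m, h⟩ else zero)

end WithNewZero

end Monoids

section Skew

variable {A : Type*} [TopologicalSpace A] {M : Type*} [Monoid M]

lemma S_mem (X : SymbolicDynamics.FullShift.Subshift A ℤ) {x : ℤ → A} (hx : x ∈ X.carrier) :
    S x ∈ X.carrier := by
  have h := X.mapsTo 1 hx
  have e : S x = shift (1 : ℤ) x := by
    funext n
    simp [S, add_comm]
  rw [e]
  exact h

/-- The phase space `(R ∪ {0}) × X` of the skew product. -/
abbrev SkewSpace (R : Set M) (X : SymbolicDynamics.FullShift.Subshift A ℤ) : Type _ :=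
  WithNewZero R × X.carrier

/-- The skew product transformation `T(r, x) = (r · φ(x_0), S x)`. -/
def skewMap (φ : FreeMonoid A →* M) (R : Set M)
    (X : SymbolicDynamics.FullShift.Subshift A ℤ) (p : SkewSpace R X) : SkewSpace R X :=
  (p.1.act (φ (FreeMonoid.of (p.2.1 0))), ⟨S p.2.1, S_mem X p.2.2⟩)

/-- The right cylinder `[L]_X`: the elements of `X` that have some `w ∈ L` as the word read
from position `0`. -/
def cylinder (X : SymbolicDynamics.FullShift.Subshift A ℤ) (L : Set (FreeMonoid A)) :
    Set X.carrier :=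
  {x | ∃ w ∈ L, factor x.1 0 w.length = w}

/-- The set `U_{r,V} = {r} × V`. -/
def U {R : Set M} {X : SymbolicDynamics.FullShift.Subshift A ℤ} (r : WithNewZero R)
    (V : Set X.carrier) : Set (SkewSpace R X) :=
  {r} ×ˢ V

/-- `ν` is an ergodic probability measure on the skew product `(R ∪ {0}) ⋊ X` that gives
`{0} × X` measure zero and projects to `μ`. -/
structure IsErgodicLift [MeasurableSpace A] (φ : FreeMonoid A →* M) (R : Set M)
    (X : SymbolicDynamics.FullShift.Subshift A ℤ) (μ : Measure (ℤ → A))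
    (ν : Measure (SkewSpace R X)) : Prop where
  isProbabilityMeasure : IsProbabilityMeasure ν
  ergodic : Ergodic (skewMap φ R X) ν
  zero_null : ν (U WithNewZero.zero Set.univ) = 0
  map_eq : ν.map (fun p => (p.2 : ℤ → A)) = μ

end Skew

end SkewDensity

end

namespace SkewDensity

namespace WithNewZero

variable {M : Type*} {R : Set M}

/-! By recurrence, almost every point reads every word of the language, so its long prefixes map
into `minimalIdeal`; a word of the language mapped there lands in `minimalJClass`. This gives
density zero off that class (`hasDensity_zero_of_notMem_minimalJClass`).

For the formula, fix an ergodic lift and a state `r` with `r * m ∈ R`. Reading a prefix with image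
`m` takes `r` to `r * m`. Conversely, if `m` has already been read and the state at time `i` is `r *
m`, stability of finite monoids cancels `r` and shows that the prefix of length `i` has image `m`.
So, up to the points that first read `m` after time `i`, whose measure tends to 0, the event is
"start at `r` in the cylinder, be at `r * m` at time `i`". The mean ergodic theorem gives its Cesàro
limit as a product (`IsErgodicLift.tendsto_cesaro_measureReal_U`).

For existence, `pastFiber` attaches to `x` the elements of `R` compatible with the whole past of
`x`. Over the support this set is nonempty, and almost everywhere multiplication by `φ (x_0)` maps
it injectively into the set over `S x`; hence counting on these fibers is an invariant finite
measure. A non-null invariant set meets almost every fiber, so it has mass at least 1. Therefore an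
ergodic piece exists, and it is normalized (`exists_isErgodicLift`). -/

lemma of_ne_zero (r : R) : of r ≠ zero := Option.some_ne_none r

lemma of_injective : Function.Injective (of : R → WithNewZero R) := Option.some_injective _

lemma eq_zero_or_eq_of (p : WithNewZero R) : p = zero ∨ ∃ r, p = of r := by
  rcases p with _ | r
  · exact Or.inl rfl
  · exact Or.inr ⟨r, rfl⟩

end WithNewZero

/-! ### Stability of finite monoids, Green's relation `𝓡` and the action on `R ∪ {0}`. -/

section FiniteMonoid

variable {M : Type*} [Monoid M]

lemma self_mem_principalIdeal (m : M) : m ∈ principalIdeal m := ⟨1, 1, by simp⟩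

lemma isTwoSidedIdeal_principalIdeal (m : M) : IsTwoSidedIdeal (principalIdeal m) := by
  rintro a b _ ⟨c, d, rfl⟩
  exact ⟨a * c, d * b, by simp only [mul_assoc]⟩

lemma IsTwoSidedIdeal.principalIdeal_subset {I : Set M} (hI : IsTwoSidedIdeal I) {m : M}
    (hm : m ∈ I) : principalIdeal m ⊆ I := by
  rintro _ ⟨a, b, rfl⟩
  exact hI a b m hm

/-- Right stability of finite monoids. -/
lemma exists_eq_mul_mul_of_mem_principalIdeal_mul [Finite M] {m a : M}
    (h : m ∈ principalIdeal (m * a)) : ∃ b, m = m * a * b := by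
  obtain ⟨x, y, hxy⟩ := h
  have hsub : principalRightIdeal (m * a) ⊆ principalRightIdeal m := by
    rintro _ ⟨b, rfl⟩
    exact ⟨a * b, by simp only [mul_assoc]⟩
  -- Left multiplication by `x` maps `m a M` onto a set containing `m M`, so the smaller ideal has
  -- at least as many elements as the larger.
  have himage : principalRightIdeal m ⊆ (x * ·) '' principalRightIdeal (m * a) := by
    rintro _ ⟨b, rfl⟩
    exact ⟨m * a * (y * b), ⟨_, rfl⟩, by
      conv_rhs => rw [hxy]
      simp only [mul_assoc]⟩
  have hcard := (Set.ncard_le_ncard himage (Set.toFinite _)).trans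
    (Set.ncard_image_le (Set.toFinite _))
  have heq := Set.eq_of_subset_of_ncard_le hsub hcard (Set.toFinite _)
  have hm : m ∈ principalRightIdeal m := ⟨1, by simp⟩
  rw [← heq] at hm
  exact hm

/-- Left stability of finite monoids. -/
lemma exists_eq_mul_mul_of_mem_principalIdeal_mul_left [Finite M] {m a : M}
    (h : m ∈ principalIdeal (a * m)) : ∃ b, m = b * (a * m) := by
  have : Finite Mᵐᵒᵖ := Finite.of_equiv M MulOpposite.opEquiv
  obtain ⟨x, y, hxy⟩ := h
  obtain ⟨b, hb⟩ := exists_eq_mul_mul_of_mem_principalIdeal_mul (M := Mᵐᵒᵖ)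
    (m := MulOpposite.op m) (a := MulOpposite.op a)
    ⟨MulOpposite.op y, MulOpposite.op x, by
      apply MulOpposite.unop_injective
      simpa [mul_assoc] using hxy⟩
  exact ⟨b.unop, by simpa [mul_assoc] using congrArg MulOpposite.unop hb⟩

lemma IsRClass.exists_mul_eq {R : Set M} (hR : IsRClass R) {r s : M} (hr : r ∈ R) (hs : s ∈ R) :
    ∃ a, r * a = s := by
  obtain ⟨t, rfl⟩ := hR
  have hs' : s ∈ principalRightIdeal s := ⟨1, by simp⟩
  rw [Set.mem_ofPred_eq] at hr hs
  rw [hs, ← hr] at hs'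
  obtain ⟨a, ha⟩ := hs'
  exact ⟨a, ha.symm⟩

lemma IsRClass.mul_mem {R : Set M} (hR : IsRClass R) {r a b : M} (hr : r ∈ R)
    (h : r * a * b = r) : r * a ∈ R := by
  obtain ⟨t, rfl⟩ := hR
  rw [Set.mem_ofPred_eq] at hr ⊢
  rw [← hr]
  apply Set.Subset.antisymm
  · rintro _ ⟨c, rfl⟩
    exact ⟨a * c, by simp only [mul_assoc]⟩
  · rintro _ ⟨c, rfl⟩
    exact ⟨b * c, by rw [← mul_assoc, h]⟩

/-- A product that has left `R` cannot return to it by further right multiplication. This is what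
makes `act` compatible with products. -/
lemma IsRClass.mem_of_mul_mem {R : Set M} (hR : IsRClass R) {r a b : M} (hr : r ∈ R)
    (h : r * a * b ∈ R) : r * a ∈ R := by
  obtain ⟨c, hc⟩ := hR.exists_mul_eq h hr
  exact hR.mul_mem hr (b := b * c) (by rw [← mul_assoc, hc])

lemma IsRClass.mem_of_mul_eq {R : Set M} (hR : IsRClass R) {r a b : M} (hr : r * a ∈ R)
    (h : r * a * b = r) : r ∈ R := by
  have := hR.mul_mem hr (a := b) (b := a) (by rw [h])
  rwa [h] at this

lemma IsRClass.nonempty {R : Set M} (hR : IsRClass R) : R.Nonempty := by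
  obtain ⟨t, rfl⟩ := hR
  exact ⟨t, rfl⟩

namespace WithNewZero

variable {R : Set M}

lemma zero_act (m : M) : (zero : WithNewZero R).act m = zero := rfl

lemma of_act {r : R} {m : M} (h : (r : M) * m ∈ R) : (of r).act m = of ⟨r * m, h⟩ := by
  unfold act of
  exact dif_pos h

lemma of_act_of_notMem {r : R} {m : M} (h : (r : M) * m ∉ R) : (of r).act m = zero := by
  unfold act of
  exact dif_neg h

lemma act_one (p : WithNewZero R) : p.act 1 = p := by
  rcases p.eq_zero_or_eq_of with rfl | ⟨r, rfl⟩
  · rfl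
  · rw [of_act (by simp)]
    congr 1
    simp

lemma act_mul (hR : IsRClass R) (p : WithNewZero R) (a b : M) :
    p.act (a * b) = (p.act a).act b := by
  rcases p.eq_zero_or_eq_of with rfl | ⟨r, rfl⟩
  · rfl
  by_cases ha : (r : M) * a ∈ R
  · rw [of_act ha]
    by_cases hb : (r : M) * a * b ∈ R
    · have hb' : (r : M) * (a * b) ∈ R := by rwa [← mul_assoc]
      rw [of_act hb', of_act hb]
      congr 2
      rw [mul_assoc]
    · have hb' : (r : M) * (a * b) ∉ R := by rwa [← mul_assoc]
      rw [of_act_of_notMem hb', of_act_of_notMem hb]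
  · have hab : (r : M) * (a * b) ∉ R := fun h => ha (hR.mem_of_mul_mem r.2 (by rwa [mul_assoc]))
    rw [of_act_of_notMem ha, of_act_of_notMem hab, zero_act]

end WithNewZero

end FiniteMonoid

/-! ### Factors of bi-infinite words. -/

section Words

variable {A : Type*}

lemma length_factor (x : ℤ → A) (i : ℤ) (n : ℕ) : (factor x i n).length = n := by
  show (List.ofFn _).length = n
  simp

@[simp]
lemma factor_zero (x : ℤ → A) (i : ℤ) : factor x i 0 = 1 := rfl

lemma factor_succ (x : ℤ → A) (i : ℤ) (n : ℕ) :
    factor x i (n + 1) = FreeMonoid.of (x i) * factor x (i + 1) n := by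
  unfold factor
  rw [List.ofFn_succ, FreeMonoid.ofList_cons]
  simp [add_assoc, add_comm (1 : ℤ)]

lemma factor_add (x : ℤ → A) (i : ℤ) (m n : ℕ) :
    factor x i (m + n) = factor x i m * factor x (i + m) n := by
  induction m generalizing i with
  | zero => simp
  | succ m ih =>
    rw [Nat.add_right_comm, factor_succ, ih, factor_succ, mul_assoc]
    congr 3
    push_cast
    ring

lemma factor_one (x : ℤ → A) (i : ℤ) : factor x i 1 = FreeMonoid.of (x i) := by
  rw [factor_succ, factor_zero, mul_one]

lemma factor_S (x : ℤ → A) (i : ℤ) (n : ℕ) : factor (S x) i n = factor x (i + 1) n := by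
  unfold factor S
  congr 2
  funext k
  congr 1
  ring

lemma factor_iterate_S (x : ℤ → A) (k : ℕ) (i : ℤ) (n : ℕ) :
    factor (S^[k] x) i n = factor x (i + k) n := by
  induction k generalizing x with
  | zero => simp
  | succ k ih =>
    rw [Function.iterate_succ_apply, ih, factor_S]
    congr 1
    push_cast
    ring

lemma factor_mem_language {X : Set (ℤ → A)} {x : ℤ → A} (hx : x ∈ X) (i : ℤ) (n : ℕ) :
    factor x i n ∈ language X :=
  ⟨x, hx, i, by rw [length_factor]⟩

lemma measurable_S [MeasurableSpace A] : Measurable (S : (ℤ → A) → ℤ → A) :=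
  measurable_pi_lambda _ fun n => measurable_pi_apply (n + 1)

lemma measurable_factor [Finite A] [MeasurableSpace A] [DiscreteMeasurableSpace A] (i : ℤ) (n : ℕ)
    (L : Set (FreeMonoid A)) : MeasurableSet {x : ℤ → A | factor x i n ∈ L} := by
  have h : Measurable fun (x : ℤ → A) (k : Fin n) => x (i + ((k : ℕ) : ℤ)) :=
    measurable_pi_lambda _ fun k => measurable_pi_apply _
  exact h (Set.toFinite {f : Fin n → A | FreeMonoid.ofList (List.ofFn f) ∈ L}).measurableSet

lemma factor_eventuallyEq [TopologicalSpace A] [DiscreteTopology A] (x : ℤ → A) (i : ℤ) (n : ℕ) :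
    {y : ℤ → A | factor y i n = factor x i n} ∈ 𝓝 x := by
  have h : Continuous fun (x : ℤ → A) (k : Fin n) => x (i + ((k : ℕ) : ℤ)) := by fun_prop
  have := (isOpen_discrete {fun k : Fin n => x (i + ((k : ℕ) : ℤ))}).preimage h
  refine Filter.mem_of_superset (this.mem_nhds rfl) fun y hy => ?_
  have hy' : (fun k : Fin n => y (i + ((k : ℕ) : ℤ))) = fun k : Fin n => x (i + ((k : ℕ) : ℤ)) := hy
  exact congrArg (fun f => FreeMonoid.ofList (List.ofFn f)) hy'

end Words

/-! ### Recurrence, irreducibility of the language, and the minimal ideal. -/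

section Cylinders

variable {A : Type*} [MeasurableSpace A] {μ : Measure (ℤ → A)}

lemma measure_factor_mem_eq [Finite A] [DiscreteMeasurableSpace A]
    (hμ : MeasurePreserving S μ μ) (i : ℤ) (n : ℕ) (L : Set (FreeMonoid A)) :
    μ {x | factor x i n ∈ L} = μ {x | factor x 0 n ∈ L} := by
  have step (i : ℤ) : μ {x | factor x (i + 1) n ∈ L} = μ {x | factor x i n ∈ L} := by
    rw [← hμ.measure_preimage (measurable_factor i n L).nullMeasurableSet]
    simp [Set.preimage, factor_S]
  induction i using Int.induction_on with
  | zero => rfl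
  | succ i ih => rw [step, ih]
  | pred i ih => rw [← ih, ← step, sub_add_cancel]

/-- Visiting `B` infinitely often is a strictly invariant property, hence null or conull; Poincaré
recurrence on `B` rules out null. -/
lemma ae_frequently_iterate_mem {Ω : Type*} [MeasurableSpace Ω] {ν : Measure Ω}
    [IsFiniteMeasure ν] {T : Ω → Ω} (hT : Ergodic T ν) {B : Set Ω} (hB : MeasurableSet B)
    (hpos : ν B ≠ 0) : ∀ᵐ x ∂ν, ∃ᶠ n in atTop, T^[n] x ∈ B := by
  have hmeas : MeasurableSet {x | ∃ᶠ n in atTop, T^[n] x ∈ B} := by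
    have : {x | ∃ᶠ n in atTop, T^[n] x ∈ B} = ⋂ N : ℕ, ⋃ n ≥ N, T^[n] ⁻¹' B := by
      ext x
      simp [frequently_atTop]
    rw [this]
    exact .iInter fun N => .iUnion fun n => .iUnion fun _ => hT.measurable.iterate n hB
  have hinv : T ⁻¹' {x | ∃ᶠ n in atTop, T^[n] x ∈ B} = {x | ∃ᶠ n in atTop, T^[n] x ∈ B} := by
    ext x
    simp only [Set.mem_preimage, Set.mem_ofPred_eq, ← Function.iterate_succ_apply]
    conv_rhs => rw [← map_add_atTop_eq_nat 1, frequently_map]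
  rcases hT.ae_mem_or_ae_notMem hmeas hinv with h | h
  · exact h
  · refine absurd ?_ hpos
    have hrec := hT.toMeasurePreserving.conservative.ae_mem_imp_frequently_image_mem
      hB.nullMeasurableSet
    rw [measure_eq_zero_iff_ae_notMem]
    filter_upwards [h, hrec] with x hx hx' hxB
    exact hx (hx' hxB)

variable [TopologicalSpace A] [DiscreteTopology A] [Finite A]

lemma ae_mem_support : ∀ᵐ x ∂μ, x ∈ μ.support := Measure.support_mem_ae

variable [DiscreteMeasurableSpace A]

lemma measure_cylinder_ne_zero (hμ : MeasurePreserving S μ μ) {w : FreeMonoid A}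
    (hw : w ∈ language μ.support) : μ {x | factor x 0 w.length ∈ ({w} : Set (FreeMonoid A))} ≠ 0 := by
  obtain ⟨x, hx, i, hxw⟩ := hw
  rw [← measure_factor_mem_eq hμ i]
  have h := (Measure.mem_support_iff_forall x).1 hx _ (factor_eventuallyEq x i w.length)
  rw [hxw] at h
  exact h.ne'

lemma ae_frequently_factor_eq [IsFiniteMeasure μ] (hμ : Ergodic S μ) {w : FreeMonoid A}
    (hw : w ∈ language μ.support) : ∀ᵐ x ∂μ, ∃ᶠ k : ℕ in atTop, factor x k w.length = w := by
  filter_upwards [ae_frequently_iterate_mem hμ (measurable_factor 0 w.length {w})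
    (measure_cylinder_ne_zero hμ.toMeasurePreserving hw)] with x hx
  refine hx.mono fun k hk => ?_
  have : factor (S^[k] x) 0 w.length = w := hk
  rwa [factor_iterate_S, zero_add] at this

/-- Some point of the support begins with `u` and sees `v` infinitely often, in particular after the
end of `u`. -/
lemma exists_mul_mul_mem_language [IsFiniteMeasure μ] (hμ : Ergodic S μ) {u v : FreeMonoid A}
    (hu : u ∈ language μ.support) (hv : v ∈ language μ.support) :
    ∃ t, u * t * v ∈ language μ.support := by
  have hpos := measure_cylinder_ne_zero hμ.toMeasurePreserving hu
  obtain ⟨x, hxu, hxv, hx⟩ := ((frequently_ae_mem_iff.2 hpos).and_eventually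
    ((ae_frequently_factor_eq hμ hv).and ae_mem_support)).exists
  obtain ⟨k, hk, hkv⟩ := (frequently_atTop.1 hxv) u.length
  obtain ⟨d, rfl⟩ := Nat.exists_eq_add_of_le hk
  have hxu' : factor x 0 u.length = u := hxu
  refine ⟨factor x u.length d, ?_⟩
  have := factor_mem_language hx 0 (u.length + d + v.length)
  rw [factor_add, factor_add, hxu', zero_add, zero_add, hkv] at this
  exact this

variable {M : Type*} [Monoid M]

lemma minimalIdeal_isTwoSidedIdeal {A : Type*} (φ : FreeMonoid A →* M) (X : Set (ℤ → A)) :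
    IsTwoSidedIdeal (minimalIdeal φ X) :=
  fun a b x hx I hI => hI.1 a b x (hx I hI)

lemma mem_minimalIdeal_of_mem_minimalJClass {A : Type*} {φ : FreeMonoid A →* M}
    {X : Set (ℤ → A)} {m : M} (hm : m ∈ minimalJClass φ X) : m ∈ minimalIdeal φ X := by
  have h : principalIdeal m = minimalIdeal φ X := hm
  rw [← h]
  exact self_mem_principalIdeal m

lemma mem_minimalJClass_of_mem_principalIdeal {A : Type*} {φ : FreeMonoid A →* M}
    {X : Set (ℤ → A)} {m n : M} (hm : m ∈ minimalJClass φ X) (hn : n ∈ minimalIdeal φ X)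
    (h : m ∈ principalIdeal n) : n ∈ minimalJClass φ X := by
  have hm' : principalIdeal m = minimalIdeal φ X := hm
  refine Set.Subset.antisymm
    ((minimalIdeal_isTwoSidedIdeal φ X).principalIdeal_subset hn) ?_
  rw [← hm']
  exact (isTwoSidedIdeal_principalIdeal n).principalIdeal_subset h

lemma mem_principalIdeal_of_mem_minimalJClass {A : Type*} {φ : FreeMonoid A →* M}
    {X : Set (ℤ → A)} {m n : M} (hm : m ∈ minimalJClass φ X) (hn : n ∈ minimalJClass φ X) :
    m ∈ principalIdeal n := by
  have hn' : principalIdeal n = minimalIdeal φ X := hn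
  rw [hn']
  exact mem_minimalIdeal_of_mem_minimalJClass hm

/-- The ideal generated by `φ w` itself meets the image of the language, so it contains the minimal
ideal. -/
lemma map_mem_minimalJClass {A : Type*} {φ : FreeMonoid A →* M} {X : Set (ℤ → A)}
    {w : FreeMonoid A} (hw : w ∈ language X) (h : φ w ∈ minimalIdeal φ X) :
    φ w ∈ minimalJClass φ X := by
  refine Set.Subset.antisymm ((minimalIdeal_isTwoSidedIdeal φ X).principalIdeal_subset h) ?_
  intro x hx
  exact hx _ ⟨isTwoSidedIdeal_principalIdeal _, φ w, self_mem_principalIdeal _, w, hw, rfl⟩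

/-- Take `w` whose image generates an ideal of least cardinality. If an ideal contains `φ v`,
continuing `w` to a word `w * t * v` cannot shrink the generated ideal, so `φ w` is a multiple of `φ
v`. -/
lemma exists_mem_language_map_mem_minimalIdeal [IsProbabilityMeasure μ] [Finite M]
    (hμ : Ergodic S μ) (φ : FreeMonoid A →* M) :
    ∃ w ∈ language μ.support, φ w ∈ minimalIdeal φ μ.support := by
  obtain ⟨x, hx⟩ := (ae_mem_support (μ := μ)).exists
  obtain ⟨w, hw, hmin⟩ := exists_minimalFor_of_wellFoundedLT
    (fun w => w ∈ language μ.support) (fun w => (principalIdeal (φ w)).ncard)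
    ⟨_, factor_mem_language hx 0 0⟩
  refine ⟨w, hw, ?_⟩
  rintro I ⟨hI, _, hvI, v, hv, rfl⟩
  obtain ⟨t, ht⟩ := exists_mul_mul_mem_language hμ hw hv
  have hsub : principalIdeal (φ (w * t * v)) ⊆ principalIdeal (φ w) :=
    (isTwoSidedIdeal_principalIdeal _).principalIdeal_subset
      ⟨1, φ (t * v), by simp [mul_assoc]⟩
  have hcard := hmin ht (Set.ncard_le_ncard hsub (Set.toFinite _))
  have heq := Set.eq_of_subset_of_ncard_le hsub hcard (Set.toFinite _)
  have hmem : φ w ∈ principalIdeal (φ (w * t * v)) := heq ▸ self_mem_principalIdeal _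
  refine hI.principalIdeal_subset ?_ hmem
  have := hI (φ (w * t)) 1 _ hvI
  simpa using this

end Cylinders

lemma hasDensity_zero_of_tendsto {A : Type*} [MeasurableSpace A] {μ : Measure (ℤ → A)}
    {L : Set (FreeMonoid A)}
    (h : Tendsto (fun n : ℕ => μ {x | factor x 0 n ∈ L}) atTop (𝓝 0)) : HasDensity μ L 0 := by
  have h' : Tendsto (fun n : ℕ => μ.real {x | factor x 0 n ∈ L}) atTop (𝓝 0) := by
    rw [← ENNReal.toReal_zero]
    exact (ENNReal.tendsto_toReal ENNReal.zero_ne_top).comp h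
  simpa [HasDensity] using h'.cesaro

/-! ### Words avoiding the minimal ideal have vanishing measure. -/

section Avoidance

variable {A : Type*} [MeasurableSpace A] [TopologicalSpace A] [DiscreteTopology A] [Finite A]
  [DiscreteMeasurableSpace A] {μ : Measure (ℤ → A)} [IsProbabilityMeasure μ]
  {M : Type*} [Monoid M] [Finite M]

/-- The events decrease with `n`, and a point in all of them never reads a fixed word `w` mapped
into the ideal, which happens with probability zero. -/
lemma tendsto_measure_map_factor_notMem (hμ : Ergodic S μ) (φ : FreeMonoid A →* M) :
    Tendsto (fun n : ℕ => μ {x | φ (factor x 0 n) ∉ minimalIdeal φ μ.support}) atTop (𝓝 0) := by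
  obtain ⟨w, hw, hwK⟩ := exists_mem_language_map_mem_minimalIdeal hμ φ
  let E : ℕ → Set (ℤ → A) := fun n => {x | φ (factor x 0 n) ∉ minimalIdeal φ μ.support}
  have hanti : Antitone E := by
    intro n k hnk x hx hxn
    obtain ⟨d, rfl⟩ := Nat.exists_eq_add_of_le hnk
    refine hx ?_
    rw [factor_add, map_mul]
    simpa using minimalIdeal_isTwoSidedIdeal φ μ.support 1 (φ (factor x (0 + n) d)) _ hxn
  have hmeas (n : ℕ) : MeasurableSet (E n) :=
    measurable_factor 0 n {v | φ v ∉ minimalIdeal φ μ.support}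
  have hlim := tendsto_measure_iInter_atTop (μ := μ) (fun n => (hmeas n).nullMeasurableSet) hanti
    ⟨0, measure_ne_top _ _⟩
  have hzero : μ (⋂ n, E n) = 0 := by
    rw [measure_eq_zero_iff_ae_notMem]
    filter_upwards [ae_frequently_factor_eq hμ hw] with x hx hxE
    obtain ⟨k, hk⟩ := hx.exists
    refine Set.mem_iInter.1 hxE (k + w.length) ?_
    rw [factor_add, zero_add, hk, map_mul]
    simpa using minimalIdeal_isTwoSidedIdeal φ μ.support (φ (factor x 0 k)) 1 _ hwK
  rwa [hzero] at hlim

lemma ae_exists_map_past_mem (hμ : Ergodic S μ) (φ : FreeMonoid A →* M) :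
    ∀ᵐ x ∂μ, ∃ n : ℕ, φ (factor x (-n) n) ∈ minimalIdeal φ μ.support := by
  rw [ae_iff]
  refine le_antisymm (ge_of_tendsto' (tendsto_measure_map_factor_notMem hμ φ) fun n => ?_) zero_le
  have := measure_factor_mem_eq hμ.toMeasurePreserving (-n) n
    {v | φ v ∉ minimalIdeal φ μ.support}
  refine (measure_mono ?_).trans this.le
  intro x hx hxn
  exact hx ⟨n, hxn⟩

theorem hasDensity_zero_of_notMem_minimalJClass (hμ : Ergodic S μ) (φ : FreeMonoid A →* M) {m : M}
    (hm : m ∉ minimalJClass φ μ.support) : HasDensity μ (φ ⁻¹' {m}) 0 := by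
  apply hasDensity_zero_of_tendsto
  -- Inside the ideal but outside the `𝓙`-class, `m` is the image of no word of the language;
  -- outside the ideal, the avoidance estimate applies.
  by_cases hK : m ∈ minimalIdeal φ μ.support
  · have (n : ℕ) : μ {x | factor x 0 n ∈ φ ⁻¹' {m}} = 0 := by
      rw [measure_eq_zero_iff_ae_notMem]
      filter_upwards [ae_mem_support] with x hx hxm
      have hxm' : φ (factor x 0 n) = m := hxm
      refine hm ?_
      rw [← hxm']
      exact map_mem_minimalJClass (factor_mem_language hx _ _) (hxm' ▸ hK)
    simp only [this, tendsto_const_nhds_iff]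
  · refine tendsto_of_tendsto_of_tendsto_of_le_of_le tendsto_const_nhds
      (tendsto_measure_map_factor_notMem hμ φ) (fun _ => zero_le) fun n => measure_mono ?_
    intro x hx hxK
    have hx' : φ (factor x 0 n) = m := hx
    exact hK (hx' ▸ hxK)

end Avoidance

/-! ### The mean ergodic theorem. -/

section MeanErgodic

open scoped InnerProductSpace

variable {Ω : Type*} [MeasurableSpace Ω] {ν : Measure Ω} {T : Ω → Ω}

/-- Von Neumann's theorem gives the orthogonal projection onto the fixed functions, which are
constants by ergodicity. -/
lemma exists_tendsto_cesaro_iterate_compMeasurePreserving (hT : Ergodic T ν) (f : Lp ℝ 2 ν) :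
    ∃ (q : Lp ℝ 2 ν) (c : ℝ), q =ᵐ[ν] (fun _ => c) ∧
      Tendsto (fun n : ℕ => (n : ℝ)⁻¹ • ∑ i ∈ Finset.range n,
        (Lp.compMeasurePreserving T hT.toMeasurePreserving)^[i] f) atTop (𝓝 q) := by
  let V : Lp ℝ 2 ν →L[ℝ] Lp ℝ 2 ν :=
    (Lp.compMeasurePreservingₗᵢ ℝ T hT.toMeasurePreserving).toContinuousLinearMap
  have hnorm : ‖V‖ ≤ 1 := LinearIsometry.norm_toContinuousLinearMap_le _
  obtain ⟨q, hqV, hlim⟩ : ∃ q, V q = q ∧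
      Tendsto (birkhoffAverage ℝ V _root_.id · f) atTop (𝓝 q) :=
    ⟨_, ((V.eqLocus (1 : Lp ℝ 2 ν →L[ℝ] Lp ℝ 2 ν)).orthogonalProjectionOnto f).2,
      V.tendsto_birkhoffAverage_orthogonalProjection hnorm f⟩
  have hqV' : Lp.compMeasurePreserving T hT.toMeasurePreserving q = q := hqV
  obtain ⟨c, hc⟩ := hT.eq_const_of_compMeasurePreserving_eq (g := q.1)
    (congrArg Subtype.val hqV')
  refine ⟨q, c, ?_, hlim⟩
  have h := AEEqFun.coeFn_const (μ := ν) Ω c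
  rw [← hc] at h
  exact h

variable [IsProbabilityMeasure ν]

lemma iterate_compMeasurePreserving_indicatorConstLp (hT : MeasurePreserving T ν ν) {B : Set Ω}
    (hB : MeasurableSet B) (i : ℕ) :
    (Lp.compMeasurePreserving T hT)^[i]
        (indicatorConstLp 2 hB (measure_ne_top ν _) (1 : ℝ) : Lp ℝ 2 ν) =
      indicatorConstLp 2 (hT.measurable.iterate i hB) (measure_ne_top _ _) (1 : ℝ) := by
  induction i with
  | zero => rfl
  | succ i ih =>
    rw [Function.iterate_succ_apply', ih]
    exact Lp.indicatorConstLp_compMeasurePreserving _ _ _ _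

lemma inner_indicatorConstLp_indicatorConstLp_one {C D : Set Ω} (hC : MeasurableSet C)
    (hD : MeasurableSet D) :
    ⟪(indicatorConstLp 2 hC (measure_ne_top ν _) (1 : ℝ) : Lp ℝ 2 ν),
      indicatorConstLp 2 hD (measure_ne_top ν _) (1 : ℝ)⟫_ℝ = ν.real (C ∩ D) := by
  rw [L2.inner_indicatorConstLp_one, setIntegral_congr_ae (g := D.indicator 1) hC
    (indicatorConstLp_coeFn.mono fun x hx _ => by rw [hx]; rfl),
    integral_indicator_one hD, measureReal_restrict_apply hD, Set.inter_comm]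

/-- The mean ergodic theorem for indicator functions. -/
theorem tendsto_cesaro_measure_inter_preimage (hT : Ergodic T ν) {A B : Set Ω}
    (hA : MeasurableSet A) (hB : MeasurableSet B) :
    Tendsto (fun n : ℕ => (n : ℝ)⁻¹ * ∑ i ∈ Finset.range n, ν.real (A ∩ T^[i] ⁻¹' B)) atTop
      (𝓝 (ν.real A * ν.real B)) := by
  have hTp := hT.toMeasurePreserving
  obtain ⟨q, c, hqc, hlim⟩ := exists_tendsto_cesaro_iterate_compMeasurePreserving hT
    (indicatorConstLp 2 hB (measure_ne_top _ _) 1)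
  have hkey {C : Set Ω} (hC : MeasurableSet C) :
      Tendsto (fun n : ℕ => (n : ℝ)⁻¹ * ∑ i ∈ Finset.range n, ν.real (C ∩ T^[i] ⁻¹' B)) atTop
        (𝓝 (ν.real C * c)) := by
    have h := Tendsto.inner (𝕜 := ℝ) (tendsto_const_nhds
      (x := (indicatorConstLp 2 hC (measure_ne_top ν _) (1 : ℝ) : Lp ℝ 2 ν))) hlim
    rw [L2.inner_indicatorConstLp_one, setIntegral_congr_ae (g := fun _ => c) hC
      (hqc.mono fun x hx _ => hx), setIntegral_const, smul_eq_mul] at h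
    refine h.congr fun n => ?_
    rw [inner_smul_right, inner_sum]
    congr 1
    refine Finset.sum_congr rfl fun i _ => ?_
    rw [iterate_compMeasurePreserving_indicatorConstLp,
      inner_indicatorConstLp_indicatorConstLp_one]
  -- Testing against the whole space identifies the constant, since there the averages do not depend
  -- on `n ≠ 0`.
  have hcB : c = ν.real B := by
    have h := hkey MeasurableSet.univ
    rw [probReal_univ, one_mul] at h
    refine tendsto_nhds_unique h (tendsto_const_nhds.congr' ?_)
    filter_upwards [eventually_ne_atTop 0] with n hn
    have hi (i : ℕ) : ν.real (T^[i] ⁻¹' B) = ν.real B :=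
      (hTp.iterate i).measureReal_preimage hB.nullMeasurableSet
    simp only [Set.univ_inter, hi, Finset.sum_const, Finset.card_range, nsmul_eq_mul]
    rw [inv_mul_cancel_left₀ (by exact_mod_cast hn)]
  rw [← hcB]
  exact hkey hA

end MeanErgodic

/-- Left stability cancels the factor `r`: if `r m v = r m`, then `m v = m`. -/
lemma mul_eq_of_mul_mul_eq {A M : Type*} [Monoid M] [Finite M] {φ : FreeMonoid A →* M}
    {Y : Set (ℤ → A)} {r m v : M}
    (hm : m ∈ minimalJClass φ Y) (hrm : r * m ∈ minimalJClass φ Y)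
    (h : r * (m * v) = r * m) : m * v = m := by
  obtain ⟨z, hz⟩ := exists_eq_mul_mul_of_mem_principalIdeal_mul_left
    (mem_principalIdeal_of_mem_minimalJClass hm hrm)
  calc m * v = z * (r * (m * v)) := by conv_lhs => rw [hz]
                                       simp only [mul_assoc]
    _ = m := by rw [h, ← hz]

lemma measurableSet_U {A : Type*} [TopologicalSpace A] [MeasurableSpace A] {M : Type*} {R : Set M}
    {X : SymbolicDynamics.FullShift.Subshift A ℤ} (r : WithNewZero R) {V : Set X.carrier} (hV : MeasurableSet V) :
    MeasurableSet (U r V) :=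
  (MeasurableSet.of_discrete (s := {r})).prod hV

/-! ### The density formula for a given ergodic lift. -/

section SkewProduct

variable {A : Type*} [TopologicalSpace A] {M : Type*} [Monoid M] {φ : FreeMonoid A →* M}
  {R : Set M} {X : SymbolicDynamics.FullShift.Subshift A ℤ}

lemma skewMap_iterate_fst (hR : IsRClass R) (n : ℕ) (p : SkewSpace R X) :
    ((skewMap φ R X)^[n] p).1 = p.1.act (φ (factor p.2.1 0 n)) := by
  induction n generalizing p with
  | zero => simp [WithNewZero.act_one]
  | succ n ih =>
    rw [Function.iterate_succ_apply, ih]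
    show (p.1.act (φ (FreeMonoid.of (p.2.1 0)))).act (φ (factor (S p.2.1) 0 n)) = _
    rw [factor_succ, map_mul, WithNewZero.act_mul hR, factor_S]

lemma mem_cylinder_preimage_iff {m : M} {x : X.carrier} :
    x ∈ cylinder X (φ ⁻¹' {m}) ↔ ∃ k : ℕ, φ (factor x.1 0 k) = m := by
  constructor
  · rintro ⟨w, hw, hxw⟩
    exact ⟨w.length, by rw [hxw]; exact hw⟩
  · rintro ⟨k, hk⟩
    exact ⟨factor x.1 0 k, hk, by rw [length_factor]⟩

variable [MeasurableSpace A]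

variable {μ : Measure (ℤ → A)} {ν : Measure (SkewSpace R X)}

lemma IsErgodicLift.ae_forall_iterate_fst_ne_zero (hν : IsErgodicLift φ R X μ ν) :
    ∀ᵐ p ∂ν, ∀ i : ℕ, ((skewMap φ R X)^[i] p).1 ≠ WithNewZero.zero := by
  rw [ae_all_iff]
  intro i
  have h : ∀ᵐ p ∂ν, p ∉ U (X := X) (WithNewZero.zero : WithNewZero R) Set.univ :=
    measure_eq_zero_iff_ae_notMem.1 hν.zero_null
  filter_upwards [(hν.ergodic.toMeasurePreserving.iterate i).quasiMeasurePreserving.ae h] with p hp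
  exact fun h0 => hp ⟨h0, trivial⟩

variable [Finite A] [DiscreteMeasurableSpace A]

lemma measurableSet_factor_subtype (i : ℤ) (n : ℕ) (L : Set (FreeMonoid A)) :
    MeasurableSet {x : X.carrier | factor x.1 i n ∈ L} :=
  measurable_subtype_coe (measurable_factor i n L)

lemma measurableSet_cylinder_preimage (m : M) : MeasurableSet (cylinder X (φ ⁻¹' {m})) := by
  have : cylinder X (φ ⁻¹' {m}) = ⋃ k : ℕ, {x : X.carrier | factor x.1 0 k ∈ φ ⁻¹' {m}} := by
    ext x
    rw [mem_cylinder_preimage_iff, Set.mem_iUnion]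
    rfl
  rw [this]
  exact .iUnion fun k => measurableSet_factor_subtype 0 k _

lemma IsErgodicLift.measureReal_factor (hR : IsRClass R) (hν : IsErgodicLift φ R X μ ν) (m : M)
    [Fintype {r : R // (r : M) * m ∈ R}] (i : ℕ) :
    μ.real {x | factor x 0 i ∈ φ ⁻¹' {m}} = ∑ r : {r : R // (r : M) * m ∈ R},
      ν.real (U (WithNewZero.of r.1) {x : X.carrier | factor x.1 0 i ∈ φ ⁻¹' {m}}) := by
  have := hν.isProbabilityMeasure
  have hq : Measurable fun p : SkewSpace R X => (p.2 : ℤ → A) :=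
    measurable_subtype_coe.comp measurable_snd
  rw [← measureReal_iUnion_fintype]
  · conv_lhs => rw [← hν.map_eq]
    rw [map_measureReal_apply hq (measurable_factor 0 i _)]
    refine measureReal_congr ?_
    filter_upwards [hν.ae_forall_iterate_fst_ne_zero] with p hp
    -- If `r * m ∉ R`, reading `m` would send the state to `0`, which almost surely never happens;
    -- so only the states `r` of the sum occur.
    refine propext ⟨fun hpm => ?_, fun hpm => ?_⟩
    · have hpm' : φ (factor p.2.1 0 i) = m := hpm
      rcases p.1.eq_zero_or_eq_of with h0 | ⟨r, hr⟩
      · exact absurd h0 (hp 0)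
      have hi := hp i
      rw [skewMap_iterate_fst hR, hr, hpm'] at hi
      have hrm : (r : M) * m ∈ R := by
        by_contra hrm
        exact hi (WithNewZero.of_act_of_notMem hrm)
      exact Set.mem_iUnion.2 ⟨⟨r, hrm⟩, hr, hpm⟩
    · obtain ⟨r, -, hpm'⟩ := Set.mem_iUnion.1 hpm
      exact hpm'
  · intro r s hrs
    refine Set.disjoint_left.2 fun p hpr hps => hrs ?_
    exact Subtype.ext (WithNewZero.of_injective (hpr.1.symm.trans hps.1))
  · exact fun r => measurableSet_U _ (measurableSet_factor_subtype 0 i _)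

variable [Finite M]

lemma IsErgodicLift.tendsto_cesaro_measureReal_U (hR : IsRClass R)
    (hRJ : R ⊆ minimalJClass φ X.carrier) (hν : IsErgodicLift φ R X μ ν) {m : M}
    (hm : m ∈ minimalJClass φ X.carrier) (r : R) (hrm : (r : M) * m ∈ R) :
    Tendsto (fun n : ℕ => (n : ℝ)⁻¹ * ∑ i ∈ Finset.range n,
        ν.real (U (WithNewZero.of r) {x : X.carrier | factor x.1 0 i ∈ φ ⁻¹' {m}})) atTop
      (𝓝 (ν.real (U (WithNewZero.of r) (cylinder X (φ ⁻¹' {m}))) *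
        ν.real (U (WithNewZero.of ⟨r * m, hrm⟩) (Set.univ : Set X.carrier)))) := by
  have := hν.isProbabilityMeasure
  let V : ℕ → Set X.carrier := fun i => {x | factor x.1 0 i ∈ φ ⁻¹' {m}}
  let B : Set (SkewSpace R X) := U (WithNewZero.of ⟨r * m, hrm⟩) Set.univ
  let C : ℕ → Set (SkewSpace R X) := fun i =>
    U (WithNewZero.of r) (cylinder X (φ ⁻¹' {m})) ∩ (skewMap φ R X)^[i] ⁻¹' B
  -- `D i` collects the starts at `r` that read a prefix with image `m`, but for the first time
  -- after time `i`; these sets decrease to the empty set.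
  let D : ℕ → Set (SkewSpace R X) := fun i =>
    U (WithNewZero.of r) (cylinder X (φ ⁻¹' {m}) \ ⋃ k ≤ i, V k)
  have hV (i : ℕ) : MeasurableSet (V i) := measurableSet_factor_subtype 0 i _
  have hB : MeasurableSet B := measurableSet_U _ .univ
  have hD (i : ℕ) : MeasurableSet (D i) := measurableSet_U _
    ((measurableSet_cylinder_preimage m).diff (.iUnion fun k => .iUnion fun _ => hV k))
  have hVC (i : ℕ) : U (WithNewZero.of r) (V i) ⊆ C i := by
    rintro p ⟨hpr, hpm⟩
    have hpr' : p.1 = WithNewZero.of r := hpr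
    have hpm' : φ (factor p.2.1 0 i) = m := hpm
    refine ⟨⟨hpr, mem_cylinder_preimage_iff.2 ⟨i, hpm'⟩⟩, ?_, trivial⟩
    show ((skewMap φ R X)^[i] p).1 = _
    rw [skewMap_iterate_fst hR, hpr', hpm', WithNewZero.of_act hrm]
  have hCD (i : ℕ) : C i \ U (WithNewZero.of r) (V i) ⊆ D i := by
    rintro p ⟨⟨⟨hpr, hpL⟩, hpB⟩, hpV⟩
    refine ⟨hpr, hpL, fun hpk => hpV ⟨hpr, ?_⟩⟩
    simp only [Set.mem_iUnion] at hpk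
    obtain ⟨k, hki, hk⟩ := hpk
    have hk' : φ (factor p.2.1 0 k) = m := hk
    obtain ⟨d, rfl⟩ := Nat.exists_eq_add_of_le hki
    have hpr' : p.1 = WithNewZero.of r := hpr
    have hpB' : ((skewMap φ R X)^[k + d] p).1 = WithNewZero.of ⟨r * m, hrm⟩ := hpB.1
    show φ (factor p.2.1 0 (k + d)) = m
    rw [skewMap_iterate_fst hR, hpr'] at hpB'
    have hmem : (r : M) * φ (factor p.2.1 0 (k + d)) ∈ R := by
      by_contra hmem
      rw [WithNewZero.of_act_of_notMem hmem] at hpB'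
      exact WithNewZero.of_ne_zero _ hpB'.symm
    rw [WithNewZero.of_act hmem] at hpB'
    have heq : (r : M) * φ (factor p.2.1 0 (k + d)) = r * m :=
      congrArg Subtype.val (WithNewZero.of_injective hpB')
    rw [factor_add, map_mul, hk'] at heq ⊢
    -- With `v` the image of the letters read between times `k` and `k + d`, equality of states says
    -- `r m v = r m`, hence `m v = m`.
    exact mul_eq_of_mul_mul_eq hm (hRJ hrm) heq
  have hDzero : Tendsto (fun i => ν.real (D i)) atTop (𝓝 0) := by
    have hanti : Antitone D := fun i j hij p hp =>
      ⟨hp.1, hp.2.1, fun h => hp.2.2 (Set.biUnion_subset_biUnion_left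
        (fun k (hk : k ≤ i) => hk.trans hij) h)⟩
    have hempty : ⋂ i, D i = ∅ := by
      refine Set.eq_empty_of_forall_notMem fun p hp => ?_
      rw [Set.mem_iInter] at hp
      obtain ⟨k, hk⟩ := mem_cylinder_preimage_iff.1 (hp 0).2.1
      exact (hp k).2.2 (Set.mem_biUnion (le_refl k) hk)
    have h := tendsto_measure_iInter_atTop (μ := ν) (fun n => (hD n).nullMeasurableSet) hanti
      ⟨0, measure_ne_top _ _⟩
    rw [hempty, measure_empty] at h
    rw [← ENNReal.toReal_zero]
    exact (ENNReal.tendsto_toReal ENNReal.zero_ne_top).comp h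
  have hdiff : Tendsto (fun i => ν.real (C i) - ν.real (U (WithNewZero.of r) (V i))) atTop
      (𝓝 0) := by
    refine squeeze_zero (fun i => sub_nonneg.2 (measureReal_mono (hVC i))) (fun i => ?_) hDzero
    rw [← measureReal_sdiff (hVC i) (measurableSet_U _ (hV i))]
    exact measureReal_mono (hCD i)
  have hC := tendsto_cesaro_measure_inter_preimage hν.ergodic
    (measurableSet_U (WithNewZero.of r) (measurableSet_cylinder_preimage (X := X) (φ := φ) m)) hB
  have h := hC.sub hdiff.cesaro
  rw [sub_zero] at h
  refine h.congr fun n => ?_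
  rw [← mul_sub, ← Finset.sum_sub_distrib]
  congr 1
  exact Finset.sum_congr rfl fun i _ => sub_sub_cancel _ _

theorem IsErgodicLift.hasDensity (hR : IsRClass R) (hRJ : R ⊆ minimalJClass φ X.carrier)
    (hν : IsErgodicLift φ R X μ ν) {m : M} (hm : m ∈ minimalJClass φ X.carrier) :
    HasDensity μ (φ ⁻¹' {m}) (∑ᶠ r : {r : R // (r : M) * m ∈ R},
      ν.real (U (WithNewZero.of r.1) (cylinder X (φ ⁻¹' {m}))) *
        ν.real (U (WithNewZero.of ⟨(r.1 : M) * m, r.2⟩) (Set.univ : Set X.carrier))) := by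
  have := Fintype.ofFinite {r : R // (r : M) * m ∈ R}
  rw [finsum_eq_sum_of_fintype]
  refine (tendsto_finsetSum Finset.univ fun r _ =>
    hν.tendsto_cesaro_measureReal_U hR hRJ hm r.1 r.2).congr fun n => ?_
  simp only [hν.measureReal_factor hR m, one_div]
  rw [Finset.sum_comm, Finset.mul_sum]

end SkewProduct

/-! ### Elements of `R` compatible with the past of a point. -/

section PastFiber

variable {A M : Type*} [Monoid M]

/-- The elements of `R` that are left multiples of the images of all the words
`x_{-n} ⋯ x_{-1}`. -/
def pastFiber (φ : FreeMonoid A →* M) (R : Set M) (x : ℤ → A) : Set M :=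
  {r | r ∈ R ∧ ∀ n : ℕ, ∃ z, r = z * φ (factor x (-n) n)}

variable {φ : FreeMonoid A →* M} {R : Set M}

lemma measurableSet_mem_pastFiber [MeasurableSpace A] [Finite A]
    [DiscreteMeasurableSpace A] (φ : FreeMonoid A →* M) (R : Set M) (r : R) :
    MeasurableSet {x : ℤ → A | (r : M) ∈ pastFiber φ R x} := by
  have : {x : ℤ → A | (r : M) ∈ pastFiber φ R x} =
      ⋂ n : ℕ, {x | factor x (-n) n ∈ {w | ∃ z, (r : M) = z * φ w}} := by
    ext x
    rw [Set.mem_iInter]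
    exact ⟨fun h => h.2, fun h => ⟨r.2, h⟩⟩
  rw [this]
  exact .iInter fun n => measurable_factor _ _ _

lemma exists_left_multiple_of_le {x : ℤ → A} {r : M} {n k : ℕ} (hnk : n ≤ k)
    (h : ∃ z, r = z * φ (factor x (-k) k)) : ∃ z, r = z * φ (factor x (-n) n) := by
  obtain ⟨d, rfl⟩ := Nat.exists_eq_add_of_le' hnk
  obtain ⟨z, rfl⟩ := h
  refine ⟨z * φ (factor x (-(d + n : ℕ)) d), ?_⟩
  rw [factor_add, map_mul, ← mul_assoc]
  congr 4
  push_cast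
  ring

variable [Finite M]

/-- By the pigeonhole principle one `r` serves infinitely many lengths, and a longer past includes
every shorter one. -/
lemma exists_mem_pastFiber {x : ℤ → A}
    (h : ∀ n : ℕ, ∃ r ∈ R, ∃ z, r = z * φ (factor x (-n) n)) : (pastFiber φ R x).Nonempty := by
  choose s hsR hs using h
  obtain ⟨r, hr⟩ := Finite.exists_infinite_fiber s
  have hr' : (s ⁻¹' {r}).Infinite := Set.infinite_coe_iff.1 hr
  refine ⟨r, ?_, fun n => ?_⟩
  · obtain ⟨k, hk⟩ := hr'.nonempty
    have hk' : s k = r := hk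
    exact hk' ▸ hsR k
  · obtain ⟨k, hk, hnk⟩ := hr'.exists_gt n
    have hk' : s k = r := hk
    exact exists_left_multiple_of_le hnk.le (hk' ▸ hs k)

variable {Y : Set (ℤ → A)} {x : ℤ → A} {n : ℕ}

/-- Left stability: once the past word lies in the minimal `𝓙`-class, it and `r` are left multiples
of each other. -/
lemma exists_mul_eq_of_mem_pastFiber (hRJ : R ⊆ minimalJClass φ Y) {r : M}
    (hr : r ∈ pastFiber φ R x) (hn : φ (factor x (-n) n) ∈ minimalJClass φ Y) :
    ∃ z, φ (factor x (-n) n) = z * r := by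
  obtain ⟨z, hz⟩ := hr.2 n
  have hrJ := hRJ hr.1
  rw [hz] at hrJ
  obtain ⟨b, hb⟩ := exists_eq_mul_mul_of_mem_principalIdeal_mul_left
    (mem_principalIdeal_of_mem_minimalJClass hn hrJ)
  exact ⟨b, by rw [hz]; exact hb⟩

/-- The past word is `z * r`, and appending `x_0` keeps its image in the minimal `𝓙`-class. So `r`
is a two-sided multiple of `r * φ (x_0)`, and right stability makes it a right multiple. -/
lemma exists_mul_mul_eq_of_mem_pastFiber (hRJ : R ⊆ minimalJClass φ Y)
    {r : M} (hr : r ∈ pastFiber φ R x) (hx : x ∈ Y)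
    (hn : φ (factor x (-n) n) ∈ minimalIdeal φ Y) :
    ∃ b, r = r * φ (FreeMonoid.of (x 0)) * b := by
  have hnJ := map_mem_minimalJClass (factor_mem_language hx _ _) hn
  obtain ⟨z, hz⟩ := exists_mul_eq_of_mem_pastFiber hRJ hr hnJ
  have hsucc : φ (factor x (-n) (n + 1)) = z * r * φ (FreeMonoid.of (x 0)) := by
    rw [factor_add, neg_add_cancel, factor_one, map_mul, hz]
  have hsuccJ : φ (factor x (-n) (n + 1)) ∈ minimalJClass φ Y := by
    refine map_mem_minimalJClass (factor_mem_language hx _ _) ?_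
    rw [factor_add, map_mul, ← one_mul (φ (factor x (-n) n))]
    exact minimalIdeal_isTwoSidedIdeal φ Y _ _ _ hn
  obtain ⟨c, d, hcd⟩ := mem_principalIdeal_of_mem_minimalJClass (hRJ hr.1) hsuccJ
  refine exists_eq_mul_mul_of_mem_principalIdeal_mul ⟨c * z, d, ?_⟩
  rw [hsucc] at hcd
  simpa only [mul_assoc] using hcd

lemma mul_mem_pastFiber (hR : IsRClass R) (hRJ : R ⊆ minimalJClass φ Y)
    {r : M} (hr : r ∈ pastFiber φ R x) (hx : x ∈ Y)
    (hn : φ (factor x (-n) n) ∈ minimalIdeal φ Y) :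
    r * φ (FreeMonoid.of (x 0)) ∈ pastFiber φ R (S x) := by
  obtain ⟨b, hb⟩ := exists_mul_mul_eq_of_mem_pastFiber hRJ hr hx hn
  refine ⟨hR.mul_mem hr.1 hb.symm, fun k => ?_⟩
  rcases k with _ | k
  · exact ⟨r * φ (FreeMonoid.of (x 0)), by simp⟩
  obtain ⟨z, hz⟩ := hr.2 k
  refine ⟨z, ?_⟩
  have hk : -((k + 1 : ℕ) : ℤ) + 1 = -k := by push_cast; ring
  rw [factor_S, hk, factor_add, neg_add_cancel, factor_one, map_mul, ← mul_assoc, ← hz]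

/-- Both elements are left multiples of one another through the past word, so `s` is a left multiple
of `r`. Hence the right factor `b` that undoes `φ (x_0)` on `r` also undoes it on `s`. -/
lemma eq_of_mul_eq_of_mem_pastFiber (hRJ : R ⊆ minimalJClass φ Y)
    {r s : M} (hr : r ∈ pastFiber φ R x) (hs : s ∈ pastFiber φ R x) (hx : x ∈ Y)
    (hn : φ (factor x (-n) n) ∈ minimalIdeal φ Y)
    (h : r * φ (FreeMonoid.of (x 0)) = s * φ (FreeMonoid.of (x 0))) : r = s := by
  obtain ⟨b, hb⟩ := exists_mul_mul_eq_of_mem_pastFiber hRJ hr hx hn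
  obtain ⟨z, hz⟩ := exists_mul_eq_of_mem_pastFiber hRJ hr
    (map_mem_minimalJClass (factor_mem_language hx _ _) hn)
  obtain ⟨y, hy⟩ := hs.2 n
  have hsr : s = y * z * r := by rw [hy, hz, mul_assoc]
  calc r = r * φ (FreeMonoid.of (x 0)) * b := hb
    _ = s * φ (FreeMonoid.of (x 0)) * b := by rw [h]
    _ = y * z * (r * φ (FreeMonoid.of (x 0)) * b) := by rw [hsr]; simp only [mul_assoc]
    _ = s := by rw [← hb, ← hsr]

/-- Extend the past word `w` to the left to `u * t * w`, with image in the minimal `𝓙`-class. A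
given `r ∈ R` factors through this image, and by right stability the left part of the factorization
is already in `R`. -/
lemma pastFiber_nonempty [MeasurableSpace A] [TopologicalSpace A] [DiscreteTopology A] [Finite A]
    [DiscreteMeasurableSpace A] {μ : Measure (ℤ → A)} [IsProbabilityMeasure μ]
    (hμ : Ergodic S μ) (hR : IsRClass R) (hRJ : R ⊆ minimalJClass φ μ.support)
    (hx : x ∈ μ.support) : (pastFiber φ R x).Nonempty := by
  refine exists_mem_pastFiber fun n => ?_
  obtain ⟨u, hu, huK⟩ := exists_mem_language_map_mem_minimalIdeal hμ φ
  obtain ⟨t, ht⟩ := exists_mul_mul_mem_language hμ hu (factor_mem_language hx (-n) n)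
  set w := factor x (-n) n
  have hK := minimalIdeal_isTwoSidedIdeal φ μ.support
  have hutw : φ (u * t * w) ∈ minimalJClass φ μ.support := by
    refine map_mem_minimalJClass ht ?_
    simpa [mul_assoc] using hK 1 (φ (t * w)) _ huK
  obtain ⟨r, hr⟩ := hR.nonempty
  obtain ⟨a, b, hab⟩ := mem_principalIdeal_of_mem_minimalJClass (hRJ hr) hutw
  have hmem : a * φ (u * t * w) ∈ minimalJClass φ μ.support := by
    refine mem_minimalJClass_of_mem_principalIdeal (hRJ hr) ?_ ⟨1, b, by rw [one_mul]; exact hab⟩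
    simpa using hK a 1 _ (mem_minimalIdeal_of_mem_minimalJClass hutw)
  have hrJ := hRJ hr
  rw [hab] at hrJ
  obtain ⟨c, hc⟩ := exists_eq_mul_mul_of_mem_principalIdeal_mul
    (mem_principalIdeal_of_mem_minimalJClass hmem hrJ)
  refine ⟨a * φ (u * t * w), hR.mem_of_mul_eq (a := b) (b := c) (hab ▸ hr) hc.symm,
    a * φ (u * t), ?_⟩
  rw [map_mul, ← mul_assoc]

end PastFiber

/-! ### Counting fibers and extracting an ergodic component. -/

section ErgodicComponents

/-- Each sum is the integral of the number of indices whose set contains `x`, and the injections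
compare these numbers pointwise. -/
lemma sum_measure_le_of_injective {α ι : Type*} [Fintype ι] [MeasurableSpace α] {κ : Measure α}
    {G H : ι → Set α} (hG : ∀ i, MeasurableSet (G i)) (hH : ∀ i, MeasurableSet (H i))
    (h : ∀ᵐ x ∂κ, ∃ f : {i // x ∈ G i} → {i // x ∈ H i}, Function.Injective f) :
    ∑ i, κ (G i) ≤ ∑ i, κ (H i) := by
  classical
  have hsum {E : ι → Set α} (hE : ∀ i, MeasurableSet (E i)) :
      ∑ i, κ (E i) = ∫⁻ x, (Nat.card {i // x ∈ E i} : ENNReal) ∂κ := by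
    simp_rw [← lintegral_indicator_one (hE _)]
    rw [← lintegral_finsetSum _ fun i _ => measurable_one.indicator (hE i)]
    refine lintegral_congr fun x => ?_
    rw [Nat.card_eq_fintype_card, Fintype.card_subtype, Finset.card_filter]
    push_cast
    rfl
  rw [hsum hG, hsum hH]
  refine lintegral_mono_ae (h.mono fun x hx => ?_)
  obtain ⟨f, hf⟩ := hx
  exact_mod_cast Nat.card_le_card_of_injective f hf

/-- If the measures of the non-null invariant sets are bounded below, then some non-null
invariant set carries an ergodic restriction. -/
lemma exists_ergodic_restrict {Ω : Type*} [MeasurableSpace Ω] {ν : Measure Ω} [IsFiniteMeasure ν]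
    {T : Ω → Ω} (hT : MeasurePreserving T ν ν) (hν : ν Set.univ ≠ 0)
    (h : ∀ E, MeasurableSet E → T ⁻¹' E = E → ν E ≠ 0 → 1 ≤ ν E) :
    ∃ E, MeasurableSet E ∧ ν E ≠ 0 ∧ Ergodic T (ν.restrict E) := by
  let I : Set ENNReal := {t | ∃ E, MeasurableSet E ∧ T ⁻¹' E = E ∧ ν E ≠ 0 ∧ ν E = t}
  have huniv : ν Set.univ ∈ I := ⟨Set.univ, .univ, rfl, hν, rfl⟩
  have hI : sInf I ≠ ⊤ := ne_top_of_le_ne_top (measure_ne_top ν _) (sInf_le huniv)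
  -- A set within less than 1 of the infimum cannot split into two non-null invariant parts: one has
  -- mass at least the infimum, the other at least 1.
  obtain ⟨_, ⟨E, hE, hTE, hE0, rfl⟩, hlt⟩ := sInf_lt_iff.1 (ENNReal.lt_add_right hI one_ne_zero)
  refine ⟨E, hE, hE0, ?_, ⟨fun s hs hTs => ?_⟩⟩
  · have := hT.restrict_preimage hE
    rwa [hTE] at this
  · have hzero : ν (s ∩ E) = 0 ∨ ν (sᶜ ∩ E) = 0 := by
      by_contra! hne
      have h1 : sInf I ≤ ν (s ∩ E) :=
        sInf_le ⟨_, hs.inter hE, by rw [Set.preimage_inter, hTs, hTE], hne.1, rfl⟩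
      have h2 : 1 ≤ ν (sᶜ ∩ E) := h _ (hs.compl.inter hE)
        (by rw [Set.preimage_inter, Set.preimage_compl, hTs, hTE]) hne.2
      have h3 : ν (s ∩ E) + ν (sᶜ ∩ E) = ν E := by
        rw [Set.inter_comm, Set.inter_comm sᶜ, ← Set.sdiff_eq, measure_inter_add_sdiff E hs]
      exact absurd hlt (not_lt.2 (h3 ▸ add_le_add h1 h2))
    rw [eventuallyConst_set]
    rcases hzero with h0 | h0
    · right
      rw [← Measure.restrict_apply hs, measure_eq_zero_iff_ae_notMem] at h0
      exact h0
    · left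
      rw [← Measure.restrict_apply hs.compl, measure_eq_zero_iff_ae_notMem] at h0
      filter_upwards [h0] with x hx
      exact not_not.1 hx

end ErgodicComponents

/-! ### The counting measure on the fibers and the ergodic lift. -/

section Existence

variable {A : Type*} [MeasurableSpace A] [TopologicalSpace A] {M : Type*} [Monoid M]
  {X : SymbolicDynamics.FullShift.Subshift A ℤ} {μ : Measure (ℤ → A)}

/-- The shift on a subshift. -/
def subshiftMap (X : SymbolicDynamics.FullShift.Subshift A ℤ) (x : X.carrier) : X.carrier :=
  ⟨S x.1, S_mem X x.2⟩

/-- The measure `μ` viewed on the subshift `X`. -/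
noncomputable def subshiftMeasure (X : SymbolicDynamics.FullShift.Subshift A ℤ) (μ : Measure (ℤ → A)) :
    Measure X.carrier :=
  μ.comap Subtype.val

lemma measurable_subshiftMap : Measurable (subshiftMap X) :=
  (measurable_S.comp measurable_subtype_coe).subtype_mk

lemma measurable_skewMap [Finite M] [DiscreteMeasurableSpace A] {φ : FreeMonoid A →* M}
    {R : Set M} : Measurable (skewMap φ R X) := by
  refine Measurable.prodMk ?_ (measurable_subshiftMap.comp measurable_snd)
  have hact : Measurable fun q : WithNewZero R × A => q.1.act (φ (FreeMonoid.of q.2)) :=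
    measurable_from_prod_countable_right fun p => .of_discrete
  exact hact.comp (measurable_fst.prodMk
    ((measurable_pi_apply 0).comp (measurable_subtype_coe.comp measurable_snd)))

lemma measurable_base {A : Type*} [MeasurableSpace A] [TopologicalSpace A] {M : Type*} {R : Set M}
    {X : SymbolicDynamics.FullShift.Subshift A ℤ} : Measurable fun p : SkewSpace R X => (p.2 : ℤ → A) :=
  measurable_subtype_coe.comp measurable_snd

variable {φ : FreeMonoid A →* M} {R : Set M}

/-- The points of the base whose fiber, as part of `E`, contains `r`. -/
def fiberSet (φ : FreeMonoid A →* M) (E : Set (SkewSpace R X)) (r : R) : Set X.carrier :=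
  {x | (r : M) ∈ pastFiber φ R x.1 ∧ (WithNewZero.of r, x) ∈ E}

lemma measurableSet_fiberSet [Finite A] [DiscreteMeasurableSpace A]
    {E : Set (SkewSpace R X)} (hE : MeasurableSet E) (r : R) :
    MeasurableSet (fiberSet φ E r) :=
  (measurable_subtype_coe (measurableSet_mem_pastFiber φ R r)).inter (measurable_prodMk_left hE)

/-- The lift of `μ` that is the counting measure on the fibers given by `pastFiber`. -/
noncomputable def countingLift (φ : FreeMonoid A →* M) (R : Set M)
    (X : SymbolicDynamics.FullShift.Subshift A ℤ) (μ : Measure (ℤ → A)) [Fintype R] :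
    Measure (SkewSpace R X) :=
  ∑ r : R, ((subshiftMeasure X μ).restrict {x | (r : M) ∈ pastFiber φ R x.1}).map
    fun x => (WithNewZero.of r, x)

lemma countingLift_apply [Fintype R] {E : Set (SkewSpace R X)} (hE : MeasurableSet E) :
    countingLift φ R X μ E = ∑ r : R, subshiftMeasure X μ (fiberSet φ E r) := by
  rw [countingLift, Measure.finsetSum_apply]
  refine Finset.sum_congr rfl fun r _ => ?_
  rw [Measure.map_apply measurable_prodMk_left hE,
    Measure.restrict_apply (measurable_prodMk_left hE), Set.inter_comm]
  rfl

/-- An invariant measure on the skew product whose projection is absolutely continuous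
projects to a multiple of `μ`. -/
lemma map_eq_smul_of_measurePreserving [IsProbabilityMeasure μ] (hμ : Ergodic S μ) {ν : Measure (SkewSpace R X)}
    [IsFiniteMeasure ν] (hν : MeasurePreserving (skewMap φ R X) ν ν)
    (hac : ν.map (fun p => (p.2 : ℤ → A)) ≪ μ) :
    ν.map (fun p => (p.2 : ℤ → A)) = ν Set.univ • μ := by
  have hinv : MeasurePreserving S (ν.map fun p => (p.2 : ℤ → A))
      (ν.map fun p => (p.2 : ℤ → A)) := by
    refine ⟨measurable_S, ?_⟩
    conv_rhs => rw [← hν.map_eq, Measure.map_map measurable_base hν.measurable]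
    rw [Measure.map_map measurable_S measurable_base]
    rfl
  -- An invariant measure absolutely continuous with respect to an ergodic one is a multiple of it.
  obtain ⟨c, hc⟩ := hμ.eq_smul_of_absolutelyContinuous hinv hac
  have hmass := congrArg (fun κ => κ Set.univ) hc
  simp only [Measure.map_apply measurable_base MeasurableSet.univ, Set.preimage_univ,
    Measure.smul_apply, measure_univ, smul_eq_mul, mul_one] at hmass
  rw [hc, hmass]

variable [DiscreteTopology A] [Finite A] [DiscreteMeasurableSpace A]

lemma measurePreserving_val (hX : X.carrier = μ.support) :
    MeasurePreserving Subtype.val (subshiftMeasure X μ) μ := by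
  have hmeas : MeasurableSet X.carrier := X.isClosed.measurableSet
  refine ⟨measurable_subtype_coe, ?_⟩
  rw [subshiftMeasure, (MeasurableEmbedding.subtype_coe hmeas).map_comap, Subtype.range_coe]
  refine Measure.restrict_eq_self_of_ae_mem ?_
  rw [hX]
  exact ae_mem_support

lemma measurePreserving_subshiftMap (hX : X.carrier = μ.support)
    (hμ : MeasurePreserving S μ μ) :
    MeasurePreserving (subshiftMap X) (subshiftMeasure X μ) (subshiftMeasure X μ) := by
  refine ⟨measurable_subshiftMap, ?_⟩
  have hval := measurePreserving_val hX
  ext B hB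
  obtain ⟨B', hB', rfl⟩ := hB
  rw [Measure.map_apply measurable_subshiftMap (measurable_subtype_coe hB'),
    hval.measure_preimage hB'.nullMeasurableSet, ← hμ.measure_preimage hB'.nullMeasurableSet,
    ← hval.measure_preimage (hμ.measurable hB').nullMeasurableSet]
  rfl

lemma isFiniteMeasure_countingLift [IsFiniteMeasure μ] [Fintype R] (hX : X.carrier = μ.support) :
    IsFiniteMeasure (countingLift φ R X μ) := by
  refine ⟨?_⟩
  rw [countingLift_apply .univ]
  refine ENNReal.sum_lt_top.2 fun r _ => (measure_mono (Set.subset_univ _)).trans_lt ?_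
  rw [← Set.preimage_univ (f := Subtype.val), (measurePreserving_val hX).measure_preimage
    MeasurableSet.univ.nullMeasurableSet]
  exact measure_lt_top _ _

lemma map_countingLift_absolutelyContinuous [Fintype R] (hX : X.carrier = μ.support) :
    (countingLift φ R X μ).map (fun p => (p.2 : ℤ → A)) ≪ μ := by
  refine Measure.AbsolutelyContinuous.mk fun B hB h0 => ?_
  rw [Measure.map_apply measurable_base hB, countingLift_apply (measurable_base hB)]
  refine Finset.sum_eq_zero fun r _ => measure_mono_null (t := Subtype.val ⁻¹' B) ?_ ?_
  · exact fun x hx => hx.2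
  · rw [(measurePreserving_val hX).measure_preimage hB.nullMeasurableSet, h0]

variable [IsProbabilityMeasure μ] [Finite M]

lemma one_le_countingLift_univ [Fintype R] (hX : X.carrier = μ.support)
    (hμ : Ergodic S μ) (hR : IsRClass R) (hRJ : R ⊆ minimalJClass φ X.carrier) :
    1 ≤ countingLift φ R X μ Set.univ := by
  rw [countingLift_apply .univ]
  have huniv : (⋃ r : R, fiberSet φ Set.univ r : Set X.carrier) = Set.univ := by
    refine Set.eq_univ_of_forall fun x => ?_
    obtain ⟨r, hr⟩ := pastFiber_nonempty (φ := φ) hμ hR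
      (by rwa [← hX]) (by rw [← hX]; exact x.2)
    exact Set.mem_iUnion.2 ⟨⟨r, hr.1⟩, hr, trivial⟩
  calc 1 = subshiftMeasure X μ Set.univ := by
        rw [← measure_univ (μ := μ), ← (measurePreserving_val hX).measure_preimage
          MeasurableSet.univ.nullMeasurableSet, Set.preimage_univ]
    _ = subshiftMeasure X μ (⋃ r : R, fiberSet φ Set.univ r) := by rw [huniv]
    _ ≤ _ := measure_iUnion_fintype_le _ _

lemma measurePreserving_skewMap_countingLift [Fintype R] (hX : X.carrier = μ.support)
    (hμ : Ergodic S μ) (hR : IsRClass R) (hRJ : R ⊆ minimalJClass φ X.carrier) :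
    MeasurePreserving (skewMap φ R X) (countingLift φ R X μ) (countingLift φ R X μ) := by
  have hfin := isFiniteMeasure_countingLift (φ := φ) (R := R) hX
  have hS := measurePreserving_subshiftMap hX hμ.toMeasurePreserving
  -- The total masses are finite and agree, so one inequality suffices; injectivity on fibers
  -- provides it, and surjectivity need not be checked.
  refine ⟨measurable_skewMap, Measure.eq_of_le_of_measure_univ_eq ?_
    (by rw [Measure.map_apply measurable_skewMap .univ, Set.preimage_univ])⟩
  refine Measure.le_iff.2 fun E hE => ?_
  rw [Measure.map_apply measurable_skewMap hE, countingLift_apply (measurable_skewMap hE),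
    countingLift_apply hE]
  have hinv (r : R) : subshiftMeasure X μ (fiberSet φ E r) =
      subshiftMeasure X μ (subshiftMap X ⁻¹' fiberSet φ E r) :=
    (hS.measure_preimage (measurableSet_fiberSet hE r).nullMeasurableSet).symm
  simp_rw [hinv]
  refine sum_measure_le_of_injective
    (fun r => measurableSet_fiberSet (measurable_skewMap hE) r)
    (fun r => measurable_subshiftMap (measurableSet_fiberSet hE r)) ?_
  filter_upwards [(measurePreserving_val hX).quasiMeasurePreserving.ae
    (ae_exists_map_past_mem hμ φ)] with x hx
  obtain ⟨n, hn⟩ := hx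
  rw [← hX] at hn
  have hmul (r : {r : R // x ∈ fiberSet φ (skewMap φ R X ⁻¹' E) r}) :
      (r : M) * φ (FreeMonoid.of (x.1 0)) ∈ pastFiber φ R (S x.1) :=
    mul_mem_pastFiber hR hRJ r.2.1 x.2 hn
  refine ⟨fun r => ⟨⟨_, (hmul r).1⟩, hmul r, ?_⟩, fun r s hrs => ?_⟩
  · have h : skewMap φ R X (WithNewZero.of r.1, x) ∈ E := r.2.2
    have hact : skewMap φ R X (WithNewZero.of r.1, x) =
        (WithNewZero.of ⟨_, (hmul r).1⟩, subshiftMap X x) :=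
      Prod.ext (WithNewZero.of_act (hmul r).1) rfl
    rwa [hact] at h
  · have h : (r : M) * φ (FreeMonoid.of (x.1 0)) = s * φ (FreeMonoid.of (x.1 0)) :=
      congrArg (fun t => ((t.1 : R) : M)) hrs
    exact Subtype.ext (Subtype.ext (eq_of_mul_eq_of_mem_pastFiber hRJ r.2.1 s.2.1 x.2 hn h))

/-- The restriction to `E` projects to a positive multiple of `μ`, so `E` meets the fiber over
almost every point and contributes at least one element there. -/
lemma one_le_countingLift_of_invariant [Fintype R] (hX : X.carrier = μ.support)
    (hμ : Ergodic S μ) (hR : IsRClass R) (hRJ : R ⊆ minimalJClass φ X.carrier) {E : Set (SkewSpace R X)}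
    (hE : MeasurableSet E) (hTE : skewMap φ R X ⁻¹' E = E) (hE0 : countingLift φ R X μ E ≠ 0) :
    1 ≤ countingLift φ R X μ E := by
  have hfin := isFiniteMeasure_countingLift (φ := φ) (R := R) hX
  have hval := measurePreserving_val hX
  have hrestrict := (measurePreserving_skewMap_countingLift hX hμ hR hRJ).restrict_preimage hE
  rw [hTE] at hrestrict
  have hmap := map_eq_smul_of_measurePreserving hμ hrestrict
    ((Measure.map_mono Measure.restrict_le_self measurable_base).absolutelyContinuous.trans
      (map_countingLift_absolutelyContinuous hX))
  obtain ⟨B, hB, hBeq⟩ : MeasurableSet (⋃ r : R, fiberSet φ E r) :=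
    .iUnion fun r => measurableSet_fiberSet hE r
  have hBc : μ Bᶜ = 0 := by
    have h := congrArg (fun κ => κ Bᶜ) hmap
    simp only [Measure.map_apply measurable_base hB.compl, Measure.smul_apply, smul_eq_mul,
      Measure.restrict_apply_univ] at h
    rw [Measure.restrict_apply (measurable_base hB.compl),
      countingLift_apply ((measurable_base hB.compl).inter hE), Finset.sum_eq_zero] at h
    · exact (mul_eq_zero.1 h.symm).resolve_left hE0
    · intro r _
      -- Points outside `B` have no fiber element in `E`, so the projected restriction vanishes on
      -- `Bᶜ`.
      have : fiberSet φ ((fun p : SkewSpace R X => (p.2 : ℤ → A)) ⁻¹' Bᶜ ∩ E) r = ∅ := by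
        refine Set.eq_empty_of_forall_notMem fun x hx => hx.2.1 ?_
        have hxB : x ∈ ⋃ r : R, fiberSet φ E r := Set.mem_iUnion.2 ⟨r, hx.1, hx.2.2⟩
        rwa [← hBeq] at hxB
      rw [this, measure_empty]
  calc 1 = μ B := ((prob_compl_eq_zero_iff hB).1 hBc).symm
    _ = subshiftMeasure X μ (⋃ r : R, fiberSet φ E r) := by
        rw [← hBeq, hval.measure_preimage hB.nullMeasurableSet]
    _ ≤ ∑ r : R, subshiftMeasure X μ (fiberSet φ E r) := measure_iUnion_fintype_le _ _
    _ = countingLift φ R X μ E := (countingLift_apply hE).symm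

theorem exists_isErgodicLift (hX : X.carrier = μ.support) (hμ : Ergodic S μ)
    (hR : IsRClass R) (hRJ : R ⊆ minimalJClass φ X.carrier) :
    ∃ ν : Measure (SkewSpace R X), IsErgodicLift φ R X μ ν := by
  have := Fintype.ofFinite R
  have hfin := isFiniteMeasure_countingLift (φ := φ) (R := R) hX
  obtain ⟨E, hE, hE0, herg⟩ := exists_ergodic_restrict
    (measurePreserving_skewMap_countingLift hX hμ hR hRJ)
    (one_pos.trans_le (one_le_countingLift_univ hX hμ hR hRJ)).ne'
    fun E hE hTE hE0 => one_le_countingLift_of_invariant hX hμ hR hRJ hE hTE hE0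
  set κ := countingLift φ R X μ with hκ
  have hmap := map_eq_smul_of_measurePreserving hμ herg.toMeasurePreserving
    ((Measure.map_mono Measure.restrict_le_self measurable_base).absolutelyContinuous.trans
      (map_countingLift_absolutelyContinuous hX))
  rw [Measure.restrict_apply_univ] at hmap
  have hcancel : (κ E)⁻¹ * κ E = 1 := ENNReal.inv_mul_cancel hE0 (measure_ne_top _ _)
  refine ⟨(κ E)⁻¹ • κ.restrict E, ⟨?_⟩, herg.smul_measure _, ?_, ?_⟩
  · rw [Measure.smul_apply, Measure.restrict_apply_univ, smul_eq_mul, hcancel]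
  · have hU : MeasurableSet (U (X := X) (WithNewZero.zero : WithNewZero R) Set.univ) :=
      measurableSet_U _ .univ
    have h0 : κ (U WithNewZero.zero Set.univ) = 0 := by
      rw [hκ, countingLift_apply hU]
      refine Finset.sum_eq_zero fun r _ => measure_mono_null (t := ∅) ?_ measure_empty
      exact fun x hx => WithNewZero.of_ne_zero r hx.2.1
    rw [Measure.smul_apply, Measure.restrict_apply hU,
      measure_mono_null Set.inter_subset_left h0, smul_zero]
  · rw [Measure.map_smul, hmap, smul_smul, hcancel, one_smul]

end Existence

end SkewDensity

theorem mainTheorem2 {A : Type*} [Finite A] [TopologicalSpace A] [DiscreteTopology A]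
    [MeasurableSpace A] [DiscreteMeasurableSpace A] {M : Type*} [Monoid M] [Finite M]
    (μ : Measure (ℤ → A)) [IsProbabilityMeasure μ] (hμ : Ergodic SkewDensity.S μ)
    (X : SymbolicDynamics.FullShift.Subshift A ℤ) (hX : X.carrier = μ.support)
    (φ : FreeMonoid A →* M) (hφ : Function.Surjective φ) :
    (∀ m : M, m ∉ SkewDensity.minimalJClass φ X.carrier →
      SkewDensity.HasDensity μ (φ ⁻¹' {m}) 0) ∧
    ∀ R : Set M, SkewDensity.IsRClass R → R ⊆ SkewDensity.minimalJClass φ X.carrier →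
      (∃ ν : Measure (SkewDensity.SkewSpace R X), SkewDensity.IsErgodicLift φ R X μ ν) ∧
      ∀ m ∈ SkewDensity.minimalJClass φ X.carrier,
        ∀ ν : Measure (SkewDensity.SkewSpace R X), SkewDensity.IsErgodicLift φ R X μ ν →
          SkewDensity.HasDensity μ (φ ⁻¹' {m})
            (∑ᶠ r : {r : R // (r : M) * m ∈ R},
              ν.real (SkewDensity.U (SkewDensity.WithNewZero.of r.1)
                  (SkewDensity.cylinder X (φ ⁻¹' {m}))) *
                ν.real (SkewDensity.U
                  (SkewDensity.WithNewZero.of ⟨(r.1 : M) * m, r.2⟩) Set.univ)) := by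
  refine ⟨fun m hm => ?_, fun R hR hRJ => ⟨?_, fun m hm ν hν => ?_⟩⟩
  · rw [hX] at hm
    exact SkewDensity.hasDensity_zero_of_notMem_minimalJClass hμ φ hm
  · exact SkewDensity.exists_isErgodicLift hX hμ hR hRJ
  · exact hν.hasDensity hR hRJ hm
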